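/- Fix $1<p<\infty$. Let $L_p=L_p([0,1])$ be the real $L_p$ space of Lebesgue measure; $\langle S\rangle$ and $[S]$ denote linear span and closed linear span. For $I=[a,b)\subset[0,1]$ let $T_I:L_p\to L_p$ be given by $(T_If)(t)=f(\frac{t-a}{b-a})$ for $t\in I$ and $(T_If)(t)=0$ otherwise. Let $\mathcal D^n$ be the set of dyadic intervals $[\frac{i-1}{2^n},\frac i{2^n})$, $1\le i\le 2^n$, and let $L_p^{n,0}$ be the space of mean zero functions in $\langle \chi_I:I\in\mathcal D^n\rangle$. A linear operator $T$ between subspaces of $L_p$ spaces (over probability spaces) is a distributional embedding if $Tf$ has the same distribution as $f$ for every $f$; two such subspaces are distributionally isomorphic ($\equiv^{\mathrm{dist}}$) if there is a distributional embedding of one onto the other. A family $(Y_i)_i$ of subspaces of $L_p$ is independent if for every choice $f_i\in Y_i$ the random variables $(f_i)_i$ are independent. The independent sum $(\sum_i B_i)_{\mathrm{Ind},p}$ of subspaces $B_i\subset L_p(\Omega_i,\mu_i)$ is the closed linear span in $L_p(\prod_i\Omega_i,\prod_i\mu_i)$ of all functions $\omega\mapsto f(\omega_i)$ with $f\in B_i$.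 For every limit ordinal $\alpha<\omega_1$ fix distributional embeddings $T^\alpha_\beta:L_p\to L_p$, $0\le\beta<\alpha$, with independent ranges, that is, $(T^\alpha_\beta f_\beta)_{\beta<\alpha}$ is independent for every family $(f_\beta)_{\beta<\alpha}$ in $L_p$. Define, by recursion on $\alpha<\omega_1$, $R_0^p=\langle\chi_{[0,1]}\rangle$, $R_{\beta+1}^p=T_{[0,1/2)}(R_\beta^p)+T_{[1/2,1)}(R_\beta^p)$, and $R_\alpha^p=[T_\beta^\alpha(R_\beta^p):\beta<\alpha]$ for limit $\alpha$. Let $R_\alpha^{p,0}=\{f\in R_\alpha^p:\mathbb E(f)=0\}$. Every ordinal $\alpha$ is uniquely $\alpha=\xi+\kappa(\alpha)$ with $\xi$ zero or a limit ordinal and $\kappa(\alpha)$ a non-negative integer. Trees $\mathcal T_\alpha$, $\alpha<\omega_1$, of finite sequences, ordered by initial segments, are defined recursively: $\mathcal T_0=\emptyset$; $\mathcal T_n=\{(n)\}$ for integers $n\ge1$; $\mathcal T_\alpha=\bigcup_{1\le\beta<\alpha}\{(\alpha)^\frown\mu:\mu\in\mathcal T_\beta\}$ for limit $\alpha$; and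 $\mathcal T_\alpha=\{(\alpha)\}\cup\bigcup_{I\in\mathcal D^{\kappa(\alpha)}}\{(\alpha,I)^\frown\mu:\mu\in\mathcal T_\xi\}$ for an infinite successor $\alpha=\xi+\kappa(\alpha)$. The last entry of $\lambda\in\mathcal T_\alpha$ is a successor ordinal, written $b(\lambda)+\kappa(\lambda)$ with $b(\lambda)$ zero or a limit ordinal and $\kappa(\lambda)\ge 1$ an integer. A root of $\mathcal T_\alpha$ is a member with no proper initial segment in $\mathcal T_\alpha$. For $\lambda\in\mathcal T_\alpha$ the operator $T_\lambda:L_p\to L_p$ is given by $T_{(\alpha)}=\mathrm{id}$ for successor $\alpha$, $T_{(\alpha)^\frown\mu}=T_\beta^\alpha T_\mu$ for limit $\alpha$ and $\mu\in\mathcal T_\beta$, $1\le\beta<\alpha$, and $T_{(\alpha,I)^\frown\mu}=T_IT_\mu$ for infinite successor $\alpha$. Put $X_\lambda=T_\lambda(L_p^{\kappa(\lambda),0})$ and $Y_\lambda=[X_\mu:\mu\in\mathcal T_\alpha,\ \lambda\text{ an initial segment of }\mu]$. Then, for every $\alpha<\omega_1$: (a) for every $\lambda\in\mathcal T_\alpha$,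 $T_\lambda\big(R^{p,0}_{b(\lambda)+\kappa(\lambda)}\big)=Y_\lambda$; (b) the spaces $Y_\lambda$, $\lambda$ ranging over the roots of $\mathcal T_\alpha$, are independent, and $$R_\alpha^{p,0}\equiv^{\mathrm{dist}}\Big(\sum_{\lambda\text{ root of }\mathcal T_\alpha}R^{p,0}_{b(\lambda)+\kappa(\lambda)}\Big)_{\mathrm{Ind},p}.$$ -/

import Mathlib

open MeasureTheory ProbabilityTheory Set
open scoped ENNReal Ordinal

namespace BRS

noncomputable section

/-! ## The space `L_p = L_p[0,1]` -/

/-- Lebesgue measure on the unit interval, as a probability measure on the real line. -/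
abbrev unitMeasure : Measure ℝ := volume.restrict (Icc (0 : ℝ) 1)

instance : IsProbabilityMeasure unitMeasure :=
  ⟨by simp [unitMeasure]⟩

/-- The real space `L_p[0,1]`. -/
abbrev Lp01 (p : ℝ≥0∞) : Type := Lp ℝ p unitMeasure

/-! ## Distributional notions -/

section Distributional

variable {Ω Ω' : Type*} [MeasurableSpace Ω] [MeasurableSpace Ω'] {p : ℝ≥0∞}
  {μ : Measure Ω} {ν : Measure Ω'}

/-- The distribution of an element of an `L_p` space, a Borel measure on the line. -/
def law (f : Lp ℝ p μ) : Measure ℝ := μ.map (f : Ω → ℝ)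

/-- A linear operator between subspaces of `L_p` spaces is a distributional embedding if it
preserves the law of every element. -/
def IsDistEmbedding {X : Submodule ℝ (Lp ℝ p μ)} {Y : Submodule ℝ (Lp ℝ p ν)}
    (T : X →ₗ[ℝ] Y) : Prop :=
  ∀ f : X, law (T f : Lp ℝ p ν) = law (f : Lp ℝ p μ)

/-- Two subspaces of `L_p` spaces are distributionally isomorphic if there is a distributional
embedding of the first one onto the second one. -/
def DistIso (X : Submodule ℝ (Lp ℝ p μ)) (Y : Submodule ℝ (Lp ℝ p ν)) : Prop :=
  ∃ T : X →ₗ[ℝ] Y, IsDistEmbedding T ∧ Function.Surjective T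

/-- A family of subspaces of an `L_p` space is independent if every choice of one element
from each of the subspaces is an independent family of random variables. -/
def IndepSpaces {ι : Type*} (Y : ι → Submodule ℝ (Lp ℝ p μ)) : Prop :=
  ∀ f : ∀ i, Y i, iIndepFun (fun i => ((f i : Lp ℝ p μ) : Ω → ℝ)) μ

end Distributional

/-- The independent sum of subspaces `B i` of `L_p(Ω i, μ i)`: the closed linear span, in the
`L_p` space of the product, of the copies of the `B i` depending on the `i`-th coordinate. -/
def indepSum {ι : Type*} {Ω : ι → Type*} [∀ i, MeasurableSpace (Ω i)] {p : ℝ≥0∞}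
    [Fact (1 ≤ p)] (μ : ∀ i, Measure (Ω i)) [∀ i, IsProbabilityMeasure (μ i)]
    (B : ∀ i, Submodule ℝ (Lp ℝ p (μ i))) :
    Submodule ℝ (Lp ℝ p (Measure.infinitePi μ)) :=
  (⨆ i, (B i).map (Lp.compMeasurePreservingₗ ℝ (fun (x : ∀ j, Ω j) => x i)
    (measurePreserving_eval_infinitePi μ i))).topologicalClosure

/-! ## Compressions onto intervals -/

/-- The function equal to `f ((t - a) / (b - a))` on `[a, b)` and to `0` elsewhere. -/
def compressFun (a b : ℝ) (f : ℝ → ℝ) : ℝ → ℝ :=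
  (Ico a b).indicator fun t => f ((t - a) / (b - a))

lemma measurePreserving_affine {a b : ℝ} (hab : a < b) :
    MeasurePreserving (fun t : ℝ => (t - a) / (b - a)) (volume.restrict (Icc a b))
      (ENNReal.ofReal (b - a) • unitMeasure) := by
  have hc : 0 < b - a := sub_pos.2 hab
  have h1 : MeasurePreserving (fun t : ℝ => t - a) volume volume :=
    measurePreserving_sub_right volume a
  have h2 : MeasurePreserving (fun t : ℝ => t * (b - a)⁻¹) volume
      (ENNReal.ofReal (b - a) • volume) := by
    refine ⟨by fun_prop, ?_⟩
    rw [Real.map_volume_mul_right (inv_ne_zero hc.ne'), inv_inv, abs_of_pos hc]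
  have h3 : MeasurePreserving (fun t : ℝ => (t - a) / (b - a)) volume
      (ENNReal.ofReal (b - a) • volume) := by
    simpa [Function.comp_def, div_eq_mul_inv] using h2.comp h1
  have h4 := h3.restrict_preimage (measurableSet_Icc (a := (0 : ℝ)) (b := 1))
  have h5 : (fun t : ℝ => (t - a) / (b - a)) ⁻¹' Icc 0 1 = Icc a b := by
    ext t
    simp only [mem_preimage, mem_Icc, le_div_iff₀ hc, div_le_iff₀ hc, zero_mul, one_mul]
    constructor <;> rintro ⟨h, h'⟩ <;> constructor <;> linarith
  rw [h5, Measure.restrict_smul] at h4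
  exact h4

lemma restrict_Ico_le (a b : ℝ) :
    unitMeasure.restrict (Ico a b) ≤ volume.restrict (Icc a b) :=
  (Measure.restrict_mono_measure Measure.restrict_le_self _).trans
    (Measure.restrict_mono_set _ Ico_subset_Icc_self)

lemma memLp_compressFun {p : ℝ≥0∞} (a b : ℝ) {f : ℝ → ℝ} (hf : MemLp f p unitMeasure) :
    MemLp (compressFun a b f) p unitMeasure := by
  rcases lt_or_ge a b with hab | hab
  · rw [compressFun, memLp_indicator_iff_restrict measurableSet_Ico]
    exact ((hf.smul_measure ENNReal.ofReal_ne_top).comp_measurePreserving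
      (measurePreserving_affine hab)).mono_measure (restrict_Ico_le a b)
  · simp [compressFun, Ico_eq_empty hab.not_gt]

lemma compressFun_ae_congr (a b : ℝ) {f g : ℝ → ℝ} (h : f =ᵐ[unitMeasure] g) :
    compressFun a b f =ᵐ[unitMeasure] compressFun a b g := by
  rcases lt_or_ge a b with hab | hab
  · have h1 : f =ᵐ[ENNReal.ofReal (b - a) • unitMeasure] g :=
      Measure.ae_smul_measure h _
    have h2 := (measurePreserving_affine hab).quasiMeasurePreserving.ae_eq_comp h1
    have h3 := ae_mono (restrict_Ico_le a b) h2
    filter_upwards [(ae_restrict_iff' measurableSet_Ico).1 h3] with t ht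
    by_cases hmem : t ∈ Ico a b
    · simpa [compressFun, hmem] using ht hmem
    · simp [compressFun, hmem]
  · simp [compressFun, Ico_eq_empty hab.not_gt]

/-- The operator `T_I` on `L_p[0,1]`, for the interval `I = [a, b)` in `[0, 1]`. -/
def compress (p : ℝ≥0∞) (a b : ℝ) : Lp01 p →ₗ[ℝ] Lp01 p where
  toFun f := (memLp_compressFun a b (Lp.memLp f)).toLp (compressFun a b f)
  map_add' f g := by
    rw [← MemLp.toLp_add]
    refine MemLp.toLp_congr _ _ ((compressFun_ae_congr a b (Lp.coeFn_add f g)).trans ?_)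
    exact Filter.Eventually.of_forall fun t => by
      by_cases ht : t ∈ Ico a b <;> simp [compressFun, ht]
  map_smul' c f := by
    rw [RingHom.id_apply, ← MemLp.toLp_const_smul]
    refine MemLp.toLp_congr _ _ ((compressFun_ae_congr a b (Lp.coeFn_smul c f)).trans ?_)
    exact Filter.Eventually.of_forall fun t => by
      by_cases ht : t ∈ Ico a b <;> simp [compressFun, ht]

/-! ## Dyadic intervals -/

/-- The dyadic interval `[i / 2 ^ n, (i + 1) / 2 ^ n)`, where `n` is the level and `i < 2 ^ n`
the index. -/
structure Dyadic where
  level : ℕ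
  idx : Fin (2 ^ level)

/-- The left endpoint of a dyadic interval. -/
def Dyadic.left (I : Dyadic) : ℝ := (I.idx : ℕ) / 2 ^ I.level

/-- The right endpoint of a dyadic interval. -/
def Dyadic.right (I : Dyadic) : ℝ := ((I.idx : ℕ) + 1) / 2 ^ I.level

/-- The dyadic interval as a set of reals. -/
def Dyadic.toSet (I : Dyadic) : Set ℝ := Ico I.left I.right

/-- The operator `T_I` for a dyadic interval `I`. -/
def dyadicCompress (p : ℝ≥0∞) (I : Dyadic) : Lp01 p →ₗ[ℝ] Lp01 p :=
  compress p I.left I.right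

/-- The characteristic function of a dyadic interval in `L_p[0,1]`. -/
def dyadicIndicator (p : ℝ≥0∞) (I : Dyadic) : Lp01 p :=
  indicatorConstLp p (s := I.toSet) measurableSet_Ico (measure_ne_top _ _) (1 : ℝ)

/-! ## Mean zero functions -/

/-- The subspace of the mean zero functions of `L_p[0,1]`. -/
def meanZero (p : ℝ≥0∞) [hp : Fact (1 ≤ p)] : Submodule ℝ (Lp01 p) where
  carrier := {f | ∫ t, f t ∂unitMeasure = 0}
  zero_mem' := by
    rw [mem_ofPred_eq, integral_congr_ae (Lp.coeFn_zero ℝ p unitMeasure)]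
    simp
  add_mem' {f g} hf hg := by
    rw [mem_ofPred_eq] at hf hg ⊢
    rw [integral_congr_ae (Lp.coeFn_add f g)]
    simp only [Pi.add_apply]
    rw [integral_add ((Lp.memLp f).integrable hp.out) ((Lp.memLp g).integrable hp.out), hf, hg,
      add_zero]
  smul_mem' c f hf := by
    rw [mem_ofPred_eq] at hf ⊢
    rw [integral_congr_ae (Lp.coeFn_smul c f)]
    simp only [Pi.smul_apply, smul_eq_mul]
    rw [integral_const_mul, hf, mul_zero]

/-- The space `L_p^n` spanned by the characteristic functions of the dyadic intervals of
length `1 / 2 ^ n`. -/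
def dyadicSpace (p : ℝ≥0∞) (n : ℕ) : Submodule ℝ (Lp01 p) :=
  Submodule.span ℝ {f | ∃ I : Dyadic, I.level = n ∧ f = dyadicIndicator p I}

/-- The space `L_p^{n,0}` of the mean zero functions in `L_p^n`. -/
def dyadicSpace0 (p : ℝ≥0∞) [Fact (1 ≤ p)] (n : ℕ) : Submodule ℝ (Lp01 p) :=
  dyadicSpace p n ⊓ meanZero p

/-! ## The Bourgain-Rosenthal-Schechtman spaces -/

/-- For every countable limit ordinal `α`, a family `T_β^α`, `β < α`, of distributional embeddings
of `L_p[0,1]` into itself with independent ranges. The values of `op` at other pairs of ordinals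
are irrelevant. -/
structure IndepEmbeddings (p : ℝ≥0∞) where
  op : Ordinal.{0} → Ordinal.{0} → Lp01 p →ₗ[ℝ] Lp01 p
  dist_op : ∀ α β, Order.IsSuccLimit α → α < ω₁ → β < α →
    ∀ f : Lp01 p, law (op α β f) = law f
  indep_op : ∀ α, Order.IsSuccLimit α → α < ω₁ → ∀ f : Iio α → Lp01 p,
    iIndepFun (fun β : Iio α => (op α β (f β) : ℝ → ℝ)) unitMeasure

variable {p : ℝ≥0∞} [Fact (1 ≤ p)]

/-- The space `R_α^p` as a subspace of `L_p[0,1]`, by recursion: the constants for `α = 0`,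
`T_{[0,1/2)}(R_β^p) + T_{[1/2,1)}(R_β^p)` for `α = β + 1`, and the closed linear span of the
`T_β^α(R_β^p)`, `β < α`, at a limit ordinal. -/
def R (E : IndepEmbeddings p) (α : Ordinal.{0}) : Submodule ℝ (Lp01 p) :=
  Ordinal.limitRecOn (motive := fun _ => Submodule ℝ (Lp01 p)) α
    (Submodule.span ℝ {Lp.const p unitMeasure (1 : ℝ)})
    (fun _ S => S.map (compress p 0 (1 / 2)) ⊔ S.map (compress p (1 / 2) 1))
    (fun α _ S => (⨆ (β : Ordinal.{0}) (h : β < α), (S β h).map (E.op α β)).topologicalClosure)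

/-- The space `R_α^{p,0}` of the mean zero functions in `R_α^p`. -/
def R0 (E : IndepEmbeddings p) (α : Ordinal.{0}) : Submodule ℝ (Lp01 p) :=
  R E α ⊓ meanZero p

/-! ## The trees -/

/-- The integer part `κ(α)` of an ordinal: `0` at `0` and at limits, `κ(α + 1) = κ(α) + 1`. -/
def intPart (α : Ordinal.{0}) : ℕ :=
  Ordinal.limitRecOn (motive := fun _ => ℕ) α 0 (fun _ n => n + 1) (fun _ _ _ => 0)

/-- The ordinal `ξ`, zero or a limit, with `α = ξ + κ(α)`; see `limitPart_spec`. -/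
def limitPart (α : Ordinal.{0}) : Ordinal.{0} :=
  Ordinal.limitRecOn (motive := fun _ => Ordinal.{0}) α 0 (fun _ ξ => ξ) (fun ξ _ _ => ξ)

lemma limitPart_spec (α : Ordinal.{0}) :
    (limitPart α = 0 ∨ Order.IsSuccLimit (limitPart α)) ∧ limitPart α + intPart α = α := by
  induction α using Ordinal.limitRecOn with
  | zero => simp [limitPart, intPart]
  | add_one o ih =>
    have h1 : limitPart (o + 1) = limitPart o := by simp [limitPart]
    have h2 : intPart (o + 1) = intPart o + 1 := by simp [intPart]
    rw [h1, h2]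
    refine ⟨ih.1, ?_⟩
    rw [Nat.cast_add, Nat.cast_one, ← add_assoc, ih.2]
  | limit o ho _ =>
    have h1 : limitPart o = o := by simp [limitPart, ho]
    have h2 : intPart o = 0 := by simp [intPart, ho]
    rw [h1, h2]
    exact ⟨Or.inr ho, by simp⟩

/-- The entries of the members of the trees: ordinals and dyadic intervals. -/
inductive Entry where
  | ord (α : Ordinal.{0}) : Entry
  | dyad (I : Dyadic) : Entry

/-- `InTree α l` says that the finite sequence `l` belongs to the tree `𝒯_α`:
for a limit `α`, the members are `(α)⌢μ` with `μ ∈ 𝒯_β`, `1 ≤ β < α`;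
for a successor `α = ξ + κ(α)`, they are `(α)` and `(α, I)⌢μ` with `I` a dyadic interval of
length `2 ^ (-κ(α))` and `μ ∈ 𝒯_ξ`. The tree `𝒯_0` is empty, and so `𝒯_n = {(n)}` for a positive
integer `n`. -/
inductive InTree : Ordinal.{0} → List Entry → Prop
  | limit {α β : Ordinal.{0}} {μ : List Entry} (hα : Order.IsSuccLimit α) (hβ : 1 ≤ β)
      (hβα : β < α) (hμ : InTree β μ) : InTree α (Entry.ord α :: μ)
  | top {α : Ordinal.{0}} (hα : 0 < intPart α) : InTree α [Entry.ord α]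
  | step {α : Ordinal.{0}} {I : Dyadic} {μ : List Entry} (hα : 0 < intPart α)
      (hI : I.level = intPart α) (hμ : InTree (limitPart α) μ) :
      InTree α (Entry.ord α :: Entry.dyad I :: μ)

/-- The last entry `x_l` of a finite sequence `(x_1, …, x_l)`, if it is an ordinal (as is the case
for the members of the trees), and `0` otherwise. -/
def lastOrd (l : List Entry) : Ordinal.{0} :=
  match l.getLast? with
  | some (Entry.ord α) => α
  | _ => 0

/-- `κ(λ)` is the integer part of the last entry of `λ`. -/
def kappa (l : List Entry) : ℕ := intPart (lastOrd l)

/-- `b(λ)` is the zero or limit ordinal `ξ` such that the last entry of `λ` is `ξ + κ(λ)`. -/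
def base (l : List Entry) : Ordinal.{0} := limitPart (lastOrd l)

/-- The roots of the tree `𝒯_α`: the minimal members in the initial segment order. -/
def IsRoot (α : Ordinal.{0}) (l : List Entry) : Prop :=
  InTree α l ∧ ∀ m, InTree α m → m <+: l → m = l

/-- The set of the roots of `𝒯_α`, as a type. -/
abbrev Root (α : Ordinal.{0}) : Type 1 := {l : List Entry // IsRoot α l}

/-! ## Operators and spaces indexed over the trees -/

/-- The operator `T_λ` for a member `λ` of a tree: `T_{(α)} = id`,
`T_{(α)⌢μ} = T_β^α T_μ` if `μ` starts with the ordinal `β`, and `T_{(α, I)⌢μ} = T_I T_μ`.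
The first and the last clause concern sequences that are not in any of the trees. -/
def treeOp (E : IndepEmbeddings p) : List Entry → (Lp01 p →ₗ[ℝ] Lp01 p)
  | [] => LinearMap.id
  | [Entry.ord _] => LinearMap.id
  | Entry.ord α :: Entry.ord β :: μ => E.op α β ∘ₗ treeOp E (Entry.ord β :: μ)
  | Entry.ord _ :: Entry.dyad I :: μ => dyadicCompress p I ∘ₗ treeOp E μ
  | Entry.dyad _ :: _ => LinearMap.id

/-- `X_λ = T_λ(L_p^{κ(λ),0})`. -/
def X (E : IndepEmbeddings p) (l : List Entry) : Submodule ℝ (Lp01 p) :=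
  (dyadicSpace0 p (kappa l)).map (treeOp E l)

/-- `Y_λ`, for `λ ∈ 𝒯_α`: the closed linear span of the `X_μ` with `μ ∈ 𝒯_α` extending `λ`. -/
def Y (E : IndepEmbeddings p) (α : Ordinal.{0}) (l : List Entry) : Submodule ℝ (Lp01 p) :=
  (⨆ (m : List Entry) (_ : InTree α m) (_ : l <+: m), X E m).topologicalClosure

end

end BRS

namespace BRS

noncomputable section

/-! ## Laws and characteristic functions -/

section Laws

variable {Ω Ω' : Type*} [MeasurableSpace Ω] [MeasurableSpace Ω'] {p : ℝ≥0∞}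
  {μ : Measure Ω} {ν : Measure Ω'}

/-! The tree records the result of unfolding the recursion for `R` after the constants are removed.
Write `R_ξ` as the constants plus `R_ξ^0`. Each `T_I` sends `1` to `χ_I`, so `R_{ξ+n}^0` is
`L_p^{n,0}` plus the `T_I(R_ξ^0)`, `I` dyadic of level `n` (`R0_add_nat`). At a limit, `T_β^α` fixes
`1`, so `R_α^0` is the closed span of the `T_β^α(R_β^0)` (`R0_limit`). Iterating, `R_α^0` is the
closed span of all `X_m`, `m ∈ 𝒯_α` (`R0_eq_topologicalClosure`). The maps `T_I` and `T_β^α` are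
closed embeddings, so they commute with closed spans, and (a) follows by induction on membership in
the tree (`map_treeOp_R0`).

For (b), the path to a root crosses limit stages only, so `T_λ` is a composite of distributional
embeddings (`law_treeOp_root`). Independence is tested by multiplicativity of `E exp(i f)` on finite
sums (`cf_sum_of_roots`): roots are grouped by the ordinal `β` below the limit `α`, independence of
the ranges of the `T_β^α` separates the groups, and induction treats each group. Every member of the
tree extends a root, so the root spaces generate `R_α^0`. Finally, a closed span of independent
copies is matched with the independent sum by pairing finite sums with equal laws and passing to the
closure of the graph (`distIso_indepSum`). -/

lemma aemeasurable_coe_Lp (f : Lp ℝ p μ) : AEMeasurable (f : Ω → ℝ) μ :=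
  (Lp.aestronglyMeasurable f).aemeasurable

instance [IsProbabilityMeasure μ] (f : Lp ℝ p μ) : IsProbabilityMeasure (law f) :=
  Measure.isProbabilityMeasure_map (aemeasurable_coe_Lp f)

lemma identDistrib_of_law_eq {f : Lp ℝ p μ} {g : Lp ℝ p ν} (h : law f = law g) :
    IdentDistrib (f : Ω → ℝ) (g : Ω' → ℝ) μ ν :=
  ⟨aemeasurable_coe_Lp f, aemeasurable_coe_Lp g, h⟩

lemma norm_eq_of_law_eq {f : Lp ℝ p μ} {g : Lp ℝ p ν} (h : law f = law g) : ‖f‖ = ‖g‖ := by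
  rw [Lp.norm_def, Lp.norm_def, (identDistrib_of_law_eq h).eLpNorm_eq]

lemma integral_eq_of_law_eq {f : Lp ℝ p μ} {g : Lp ℝ p ν} (h : law f = law g) :
    ∫ t, f t ∂μ = ∫ t, g t ∂ν :=
  (identDistrib_of_law_eq h).integral_eq

/-- The value at `1` of the characteristic function of the law of `f`, that is, the expectation
of `exp (i f)`. -/
def cf (f : Lp ℝ p μ) : ℂ := charFun (law f) 1

lemma cf_eq_integral (f : Lp ℝ p μ) : cf f = ∫ w, Complex.exp (f w * Complex.I) ∂μ := by
  rw [cf, charFun_apply_real, law, integral_map (aemeasurable_coe_Lp f)]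
  · simp
  · fun_prop

lemma charFun_law (f : Lp ℝ p μ) (t : ℝ) : charFun (law f) t = cf (t • f) := by
  rw [cf_eq_integral, charFun_apply_real, law, integral_map (aemeasurable_coe_Lp f) (by fun_prop)]
  refine integral_congr_ae ?_
  filter_upwards [Lp.coeFn_smul t f] with w hw
  simp [hw]

lemma cf_eq_of_law_eq {f : Lp ℝ p μ} {g : Lp ℝ p ν} (h : law f = law g) : cf f = cf g := by
  rw [cf, cf, h]

/-- Rescaling `f` moves the argument of the characteristic function, so on linear subspaces the
single functional `cf` carries all information about laws. -/
lemma law_eq_of_cf_eq [IsProbabilityMeasure μ] [IsProbabilityMeasure ν] {f : Lp ℝ p μ}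
    {g : Lp ℝ p ν} (h : ∀ t : ℝ, cf (t • f) = cf (t • g)) : law f = law g := by
  refine Measure.ext_of_charFun (funext fun t => ?_)
  rw [charFun_law, charFun_law, h]

lemma cf_zero [IsProbabilityMeasure μ] : cf (0 : Lp ℝ p μ) = 1 := by
  have := charFun_law (0 : Lp ℝ p μ) 0
  rw [zero_smul] at this
  rw [← this, charFun_zero]
  simp

lemma cf_finset_sum {ι : Type*} {f : ι → Lp ℝ p μ}
    (h : iIndepFun (fun i => (f i : Ω → ℝ)) μ) (s : Finset ι) :
    cf (∑ i ∈ s, f i) = ∏ i ∈ s, cf (f i) := by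
  have h1 := congrFun ((h.restrict s).charFun_map_finsetSum_eq_prod
    (fun i _ => aemeasurable_coe_Lp (f i))) 1
  rw [Finset.prod_apply] at h1
  simp only [cf, law]
  rw [← h1, Measure.map_congr (Lp.coeFn_finsetSum s f)]

/-- The joint characteristic function of `(f i)` at `t` is `cf` of the combination `∑ t i • f i`, so
the hypothesis says that joint characteristic functions factor. -/
lemma iIndepFun_of_cf [IsProbabilityMeasure μ] {ι : Type*} {f : ι → Lp ℝ p μ}
    (h : ∀ (s : Finset ι) (t : ι → ℝ), cf (∑ i ∈ s, t i • f i) = ∏ i ∈ s, cf (t i • f i)) :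
    iIndepFun (fun i => (f i : Ω → ℝ)) μ := by
  classical
  rw [iIndepFun_iff_finset]
  intro s
  change iIndepFun (fun i : s => (f i : Ω → ℝ)) μ
  rw [iIndepFun_iff_charFun_pi (fun i : s => aemeasurable_coe_Lp (f i))]
  intro t
  -- The frequencies on `s` are extended by `0`; the values off `s` do not enter the sum.
  have h1 := h s (fun i => if hi : i ∈ s then t ⟨i, hi⟩ else 0)
  rw [← Finset.sum_attach, ← Finset.prod_attach] at h1
  simp only [Finset.coe_mem, dite_true, Subtype.coe_eta] at h1
  have h2 : ∀ i : s, charFun (μ.map (f i : Ω → ℝ)) (t i)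
      = cf (t i • f i) := fun i => charFun_law (f i) (t i)
  simp only [h2]
  refine Eq.trans ?_ h1
  rw [charFun_apply, integral_map, cf_eq_integral]
  · refine integral_congr_ae ?_
    filter_upwards [Lp.coeFn_finsetSum s.attach (fun i => t i • f i),
      (ae_all_iff.2 fun i : s => Lp.coeFn_smul (t i) (f i))] with w h3 h4
    rw [h3, Finset.sum_apply]
    simp only [h4]
    simp [PiLp.inner_apply, Finset.sum_mul]
  · have : AEMeasurable (fun w => fun i : s => f i w) μ :=
      aemeasurable_pi_lambda _ fun i => aemeasurable_coe_Lp (f i)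
    exact (WithLp.measurable_toLp 2 _).comp_aemeasurable this
  · fun_prop

lemma indepSpaces_of_cf [IsProbabilityMeasure μ] {ι : Type*} {Y : ι → Submodule ℝ (Lp ℝ p μ)}
    (h : ∀ (s : Finset ι) (f : ι → Lp ℝ p μ), (∀ i, f i ∈ Y i) →
      cf (∑ i ∈ s, f i) = ∏ i ∈ s, cf (f i)) : IndepSpaces Y := fun f =>
  iIndepFun_of_cf fun s t => h s (fun i => t i • (f i : Lp ℝ p μ))
    fun i => (Y i).smul_mem _ (f i).2

lemma IndepSpaces.cf_sum {ι : Type*} {Y : ι → Submodule ℝ (Lp ℝ p μ)} (h : IndepSpaces Y)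
    (s : Finset ι) {f : ι → Lp ℝ p μ} (hf : ∀ i, f i ∈ Y i) :
    cf (∑ i ∈ s, f i) = ∏ i ∈ s, cf (f i) :=
  cf_finset_sum (f := f) (h fun i => ⟨f i, hf i⟩) s

lemma integral_norm_le_norm [IsProbabilityMeasure μ] [hp : Fact (1 ≤ p)] (f : Lp ℝ p μ) :
    ∫ w, ‖f w‖ ∂μ ≤ ‖f‖ := by
  have h1 : AEStronglyMeasurable f μ := Lp.aestronglyMeasurable f
  rw [integral_norm_eq_lintegral_enorm h1, ← eLpNorm_one_eq_lintegral_enorm, Lp.norm_def]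
  exact ENNReal.toReal_mono (Lp.eLpNorm_ne_top _) (eLpNorm_le_eLpNorm_of_exponent_le hp.out h1)

/-- `cf` is 1-Lipschitz: `|e^{ix} - e^{iy}| ≤ |x - y|`, and the `L_1` norm is at most the `L_p` norm
on a probability space. Equality of laws therefore survives passage to closures. -/
lemma continuous_cf [IsProbabilityMeasure μ] [hp : Fact (1 ≤ p)] :
    Continuous (cf : Lp ℝ p μ → ℂ) := by
  have key : ∀ f g : Lp ℝ p μ, ‖cf f - cf g‖ ≤ ‖f - g‖ := by
    intro f g
    have hint : ∀ f : Lp ℝ p μ, Integrable (fun w => Complex.exp (f w * Complex.I)) μ := by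
      intro f
      refine Integrable.of_bound (C := 1) ?_ ?_
      · have h1 : Continuous fun x : ℝ => Complex.exp (x * Complex.I) := by fun_prop
        exact h1.comp_aestronglyMeasurable (Lp.aestronglyMeasurable f)
      · exact Filter.Eventually.of_forall fun w => (Complex.norm_exp_ofReal_mul_I _).le
    have h1 : Integrable (f - g : Lp ℝ p μ) μ := (Lp.memLp _).integrable hp.out
    rw [cf_eq_integral, cf_eq_integral, ← integral_sub (hint f) (hint g)]
    refine (norm_integral_le_of_norm_le h1.norm ?_).trans (integral_norm_le_norm (f - g))
    filter_upwards [Lp.coeFn_sub f g] with w hw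
    rw [hw, Pi.sub_apply]
    have h2 : Complex.exp (f w * Complex.I) - Complex.exp (g w * Complex.I) =
        Complex.exp (g w * Complex.I) * (Complex.exp (Complex.I * (f w - g w : ℝ)) - 1) := by
      rw [mul_sub, mul_one, ← Complex.exp_add]
      congr 2
      push_cast
      ring
    rw [h2, norm_mul, Complex.norm_exp_ofReal_mul_I, one_mul]
    exact Real.norm_exp_I_mul_ofReal_sub_one_le
  exact (LipschitzWith.of_dist_le_mul (K := 1) fun f g => by
    simpa [dist_eq_norm] using key f g).continuous

/-! ## Distributional isomorphisms -/

lemma isometry_of_law_eq [Fact (1 ≤ p)] {T : Lp ℝ p μ →ₗ[ℝ] Lp ℝ p ν}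
    (h : ∀ f, law (T f) = law f) : Isometry T :=
  AddMonoidHomClass.isometry_of_norm T fun f => norm_eq_of_law_eq (h f)

/-- A subspace of the product all of whose members have components with equal laws is the graph
of a distributional isomorphism, and this persists for the closures. -/
lemma distIso_closure_of_graph [IsProbabilityMeasure μ] [IsProbabilityMeasure ν]
    [hp : Fact (1 ≤ p)] (G : Submodule ℝ (Lp ℝ p μ × Lp ℝ p ν)) (hG : ∀ x ∈ G, cf x.1 = cf x.2) :
    DistIso (G.map (LinearMap.fst ℝ _ _)).topologicalClosure
      (G.map (LinearMap.snd ℝ _ _)).topologicalClosure := by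
  set H := G.topologicalClosure with hH
  have hlaw : ∀ x ∈ H, law x.1 = law x.2 := by
    intro x hx
    refine law_eq_of_cf_eq fun t => ?_
    have hc : IsClosed {x : Lp ℝ p μ × Lp ℝ p ν | cf x.1 = cf x.2} :=
      isClosed_eq (continuous_cf.comp continuous_fst) (continuous_cf.comp continuous_snd)
    exact closure_minimal hG hc (H.smul_mem t hx)
  have hnorm : ∀ x ∈ H, ‖x.1‖ = ‖x.2‖ := fun x hx => norm_eq_of_law_eq (hlaw x hx)
  let π₁ : H →ₗ[ℝ] Lp ℝ p μ := LinearMap.fst ℝ _ _ ∘ₗ H.subtype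
  let π₂ : H →ₗ[ℝ] Lp ℝ p ν := LinearMap.snd ℝ _ _ ∘ₗ H.subtype
  -- The product carries the max norm and both components of a point of `H` have equal norm, so both
  -- projections are isometries. Completeness of `H` makes their ranges closed, hence equal to the
  -- closures of the projections of `G`.
  have hcomplete : CompleteSpace H := G.isClosed_topologicalClosure.completeSpace_coe
  have h1 : Isometry π₁ := AddMonoidHomClass.isometry_of_norm π₁ fun x => by
    change ‖x.1.1‖ = max ‖x.1.1‖ ‖x.1.2‖
    rw [← hnorm x.1 x.2, max_self]
  have h2 : Isometry π₂ := AddMonoidHomClass.isometry_of_norm π₂ fun x => by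
    change ‖x.1.2‖ = max ‖x.1.1‖ ‖x.1.2‖
    rw [hnorm x.1 x.2, max_self]
  have r1 : LinearMap.range π₁ = (G.map (LinearMap.fst ℝ _ _)).topologicalClosure := by
    apply le_antisymm
    · rintro _ ⟨x, rfl⟩
      exact map_mem_closure (f := Prod.fst) continuous_fst x.2 fun y hy => ⟨y, hy, rfl⟩
    · refine Submodule.topologicalClosure_minimal _ ?_ h1.isClosedEmbedding.isClosed_range
      rintro _ ⟨x, hx, rfl⟩
      exact ⟨⟨x, G.le_topologicalClosure hx⟩, rfl⟩
  have r2 : LinearMap.range π₂ = (G.map (LinearMap.snd ℝ _ _)).topologicalClosure := by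
    apply le_antisymm
    · rintro _ ⟨x, rfl⟩
      exact map_mem_closure (f := Prod.snd) continuous_snd x.2 fun y hy => ⟨y, hy, rfl⟩
    · refine Submodule.topologicalClosure_minimal _ ?_ h2.isClosedEmbedding.isClosed_range
      rintro _ ⟨x, hx, rfl⟩
      exact ⟨⟨x, G.le_topologicalClosure hx⟩, rfl⟩
  rw [← r1, ← r2]
  let e := LinearEquiv.ofInjective π₁ h1.injective
  refine ⟨π₂.rangeRestrict ∘ₗ e.symm.toLinearMap, fun f => ?_, ?_⟩
  · obtain ⟨x, rfl⟩ := e.surjective f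
    simp only [LinearMap.comp_apply, LinearEquiv.coe_coe, LinearEquiv.symm_apply_apply]
    exact (hlaw x.1 x.2).symm
  · rw [LinearMap.coe_comp]
    exact (LinearMap.surjective_rangeRestrict π₂).comp e.symm.surjective

end Laws

/-- A subspace generated by independent distributional copies of spaces `B i` is distributionally
isomorphic to the independent sum of the `B i`. -/
lemma distIso_indepSum {Ω : Type*} [MeasurableSpace Ω] {ν : Measure Ω} [IsProbabilityMeasure ν]
    {ι : Type*} {Ω' : ι → Type*} [∀ i, MeasurableSpace (Ω' i)] {p : ℝ≥0∞}
    [Fact (1 ≤ p)] (μ : ∀ i, Measure (Ω' i)) [∀ i, IsProbabilityMeasure (μ i)]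
    (B : ∀ i, Submodule ℝ (Lp ℝ p (μ i))) (T : ∀ i, Lp ℝ p (μ i) →ₗ[ℝ] Lp ℝ p ν)
    (hT : ∀ i f, law (T i f) = law f) (hind : IndepSpaces fun i => (B i).map (T i)) :
    DistIso (⨆ i, (B i).map (T i)).topologicalClosure (indepSum μ B) := by
  let J : ∀ i, Lp ℝ p (μ i) →ₗ[ℝ] Lp ℝ p (Measure.infinitePi μ) := fun i =>
    Lp.compMeasurePreservingₗ ℝ (fun (x : ∀ j, Ω' j) => x i) (measurePreserving_eval_infinitePi μ i)
  have hJae : ∀ i (f : Lp ℝ p (μ i)), J i f =ᵐ[Measure.infinitePi μ] fun x => f (x i) :=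
    fun i f => Lp.coeFn_compMeasurePreserving f (measurePreserving_eval_infinitePi μ i)
  have hJ : ∀ i f, law (J i f) = law f := by
    intro i f
    have h1 := measurePreserving_eval_infinitePi μ i
    rw [law, law, Measure.map_congr (hJae i f)]
    have h2 : AEMeasurable (f : Ω' i → ℝ) ((Measure.infinitePi μ).map fun x => x i) := by
      rw [h1.map_eq]
      exact aemeasurable_coe_Lp f
    have h3 := AEMeasurable.map_map_of_aemeasurable h2 h1.measurable.aemeasurable
    rw [h1.map_eq] at h3
    exact h3.symm
  have hJind : ∀ f : ∀ i, Lp ℝ p (μ i), iIndepFun (fun i => (J i (f i) : (∀ j, Ω' j) → ℝ))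
      (Measure.infinitePi μ) := by
    intro f
    -- Independence of coordinate functions on the product is applied to measurable representatives
    -- and carried back by almost everywhere equality.
    have h1 : ∀ i, ∃ g : Ω' i → ℝ, Measurable g ∧ f i =ᵐ[μ i] g := fun i =>
      ⟨_, (aemeasurable_coe_Lp (f i)).measurable_mk, (aemeasurable_coe_Lp (f i)).ae_eq_mk⟩
    choose g hg hfg using h1
    refine (iIndepFun_infinitePi (X := g) hg).congr fun i => ?_
    have h2 := (measurePreserving_eval_infinitePi μ i).quasiMeasurePreserving.ae_eq_comp (hfg i)
    exact ((hJae i (f i)).trans h2).symm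
  -- `G` pairs each finite sum of the `T i (f i)` with the sum of the coordinate copies of the same
  -- `f i`; both sums have independent terms with matching laws.
  let G : Submodule ℝ (Lp ℝ p ν × Lp ℝ p (Measure.infinitePi μ)) :=
    ⨆ i, (B i).map ((T i).prod (J i))
  have hG : ∀ x ∈ G, cf x.1 = cf x.2 := by
    intro x hx
    obtain ⟨g, hg, rfl⟩ := (Submodule.mem_iSup_iff_exists_finsupp _ _).1 hx
    choose f hfB hf using hg
    simp only [Finsupp.sum, ← hf, Prod.fst_sum, Prod.snd_sum, LinearMap.prod_apply,
      Function.prod_apply]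
    rw [hind.cf_sum _ fun i => Submodule.mem_map_of_mem (hfB i), cf_finset_sum (hJind f)]
    exact Finset.prod_congr rfl fun i _ => cf_eq_of_law_eq ((hT i _).trans (hJ i _).symm)
  have h1 := distIso_closure_of_graph G hG
  simp only [G, Submodule.map_iSup, ← Submodule.map_comp, LinearMap.fst_prod, LinearMap.snd_prod]
    at h1
  exact h1

/-! ## Compressions -/

section Compress

variable {p : ℝ≥0∞} {a b : ℝ}

lemma coeFn_compress (a b : ℝ) (f : Lp01 p) :
    compress p a b f =ᵐ[unitMeasure] compressFun a b f :=
  MemLp.coeFn_toLp (memLp_compressFun a b (Lp.memLp f))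

lemma unitMeasure_restrict_Ico (ha : 0 ≤ a) (hb : b ≤ 1) :
    unitMeasure.restrict (Ico a b) = volume.restrict (Icc a b) := by
  rw [Measure.restrict_restrict measurableSet_Ico,
    inter_eq_left.2 (Ico_subset_Icc_self.trans (Icc_subset_Icc ha hb))]
  exact Measure.restrict_congr_set Ico_ae_eq_Icc

/-- The change of variables multiplies the norm by `c = (b - a)^{1/p}`; only `c > 0` matters later.
-/
lemma norm_compress (ha : 0 ≤ a) (hab : a < b) (hb : b ≤ 1) :
    ∃ c : ℝ, 0 < c ∧ ∀ f : Lp01 p, ‖compress p a b f‖ = c * ‖f‖ := by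
  have hc : ENNReal.ofReal (b - a) ≠ 0 := by simpa using hab
  refine ⟨(ENNReal.ofReal (b - a) ^ (1 / p).toReal).toReal, ?_, fun f => ?_⟩
  · exact ENNReal.toReal_pos (ENNReal.rpow_pos hc.bot_lt ENNReal.ofReal_ne_top).ne'
      (ENNReal.rpow_ne_top_of_nonneg ENNReal.toReal_nonneg ENNReal.ofReal_ne_top)
  · rw [Lp.norm_def, Lp.norm_def, eLpNorm_congr_ae (coeFn_compress a b f), compressFun,
      eLpNorm_indicator_eq_eLpNorm_restrict measurableSet_Ico, unitMeasure_restrict_Ico ha hb]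
    have h1 := eLpNorm_comp_measurePreserving (p := p)
      ((Lp.aestronglyMeasurable f).smul_measure (ENNReal.ofReal (b - a)))
      (measurePreserving_affine hab)
    rw [eLpNorm_smul_measure_of_ne_zero hc, smul_eq_mul] at h1
    rw [← ENNReal.toReal_mul, ← h1]
    rfl

lemma compress_isClosedEmbedding [Fact (1 ≤ p)] (ha : 0 ≤ a) (hab : a < b) (hb : b ≤ 1) :
    Topology.IsClosedEmbedding (compress p a b) := by
  obtain ⟨c, hc, h⟩ := norm_compress (p := p) ha hab hb
  have h1 : AntilipschitzWith (Real.toNNReal c⁻¹) (compress p a b) :=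
    AddMonoidHomClass.antilipschitz_of_bound _ fun f => by
      rw [h, Real.coe_toNNReal _ (inv_pos.2 hc).le, inv_mul_cancel_left₀ hc.ne']
  have h2 : LipschitzWith (Real.toNNReal c) (compress p a b) :=
    AddMonoidHomClass.lipschitz_of_bound _ c fun f => (h f).le
  exact h1.isClosedEmbedding h2.uniformContinuous

lemma compress_mem_meanZero [Fact (1 ≤ p)] (ha : 0 ≤ a) (hab : a < b) (hb : b ≤ 1) {f : Lp01 p}
    (hf : f ∈ meanZero p) : compress p a b f ∈ meanZero p := by
  change ∫ t, _ ∂_ = 0 at hf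
  change ∫ t, _ ∂_ = 0
  rw [integral_congr_ae (coeFn_compress a b f), compressFun, integral_indicator measurableSet_Ico,
    unitMeasure_restrict_Ico ha hb]
  have h1 := measurePreserving_affine hab
  have h2 := integral_map (μ := volume.restrict (Icc a b)) h1.measurable.aemeasurable (f := f) (by
    rw [h1.map_eq]
    exact (Lp.aestronglyMeasurable f).smul_measure _)
  rw [← h2, h1.map_eq, integral_smul_measure, hf, smul_zero]

lemma compress_compress {c d : ℝ} (hab : a < b) (hc : 0 ≤ c) (hd : d ≤ 1) (f : Lp01 p) :
    compress p a b (compress p c d f)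
      = compress p (a + (b - a) * c) (a + (b - a) * d) f := by
  have hba : 0 < b - a := sub_pos.2 hab
  apply Lp.ext
  refine (coeFn_compress _ _ _).trans
    ((compressFun_ae_congr a b (coeFn_compress c d f)).trans ((coeFn_compress _ _ f).trans ?_).symm)
  refine Filter.Eventually.of_forall fun t => ?_
  have h1 : (t - a) / (b - a) ∈ Ico c d ↔ t ∈ Ico (a + (b - a) * c) (a + (b - a) * d) := by
    rw [mem_Ico, mem_Ico, le_div_iff₀ hba, div_lt_iff₀ hba]
    constructor <;> rintro ⟨h, h'⟩ <;> constructor <;> linarith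
  by_cases ht : t ∈ Ico (a + (b - a) * c) (a + (b - a) * d)
  · have h2 : t ∈ Ico a b := by
      constructor <;> nlinarith [ht.1, ht.2]
    rw [compressFun, compressFun, indicator_of_mem ht, indicator_of_mem h2, compressFun,
      indicator_of_mem (h1.2 ht)]
    congr 1
    -- When `d = c` both denominators vanish and both quotients are `0` by convention.
    rcases eq_or_ne (d - c) 0 with h | h
    · rw [h, show a + (b - a) * d - (a + (b - a) * c) = (b - a) * (d - c) by ring, h]
      simp
    · have h3 : a + (b - a) * d - (a + (b - a) * c) ≠ 0 := by
        rw [show a + (b - a) * d - (a + (b - a) * c) = (b - a) * (d - c) by ring]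
        exact mul_ne_zero hba.ne' h
      field_simp
      ring
  · rw [compressFun, compressFun, indicator_of_notMem ht]
    by_cases h2 : t ∈ Ico a b
    · rw [indicator_of_mem h2, compressFun, indicator_of_notMem (h1.not.2 ht)]
    · rw [indicator_of_notMem h2]

lemma compress_zero_one (f : Lp01 p) : compress p 0 1 f = f := by
  apply Lp.ext
  refine (coeFn_compress _ _ _).trans ?_
  have h1 : ∀ᵐ t ∂unitMeasure, t ∈ Ico (0 : ℝ) 1 := by
    rw [unitMeasure, ← restrict_Ico_eq_restrict_Icc]
    exact ae_restrict_mem measurableSet_Ico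
  filter_upwards [h1] with t ht
  simp [compressFun, ht]

/-- The constant function `1`. -/
def one (p : ℝ≥0∞) : Lp01 p := Lp.const p unitMeasure (1 : ℝ)

lemma coeFn_one : (one p : ℝ → ℝ) =ᵐ[unitMeasure] fun _ => 1 :=
  Lp.coeFn_const _ _ _

lemma one_notMem_meanZero [Fact (1 ≤ p)] : one p ∉ meanZero p := by
  intro h
  change ∫ t, _ ∂_ = 0 at h
  rw [integral_congr_ae coeFn_one] at h
  simp at h

lemma dyadicCompress_one (I : Dyadic) : dyadicCompress p I (one p) = dyadicIndicator p I := by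
  apply Lp.ext
  refine (coeFn_compress _ _ _).trans
    ((compressFun_ae_congr _ _ coeFn_one).trans (indicatorConstLp_coeFn.trans ?_).symm)
  exact Filter.Eventually.of_forall fun t => rfl

lemma compress_one_add : compress p 0 (1 / 2) (one p) + compress p (1 / 2) 1 (one p) = one p := by
  apply Lp.ext
  have h1 : ∀ᵐ t ∂unitMeasure, t ∈ Ico (0 : ℝ) 1 := by
    rw [unitMeasure, ← restrict_Ico_eq_restrict_Icc]
    exact ae_restrict_mem measurableSet_Ico
  filter_upwards [h1, Lp.coeFn_add (compress p 0 (1 / 2) (one p)) (compress p (1 / 2) 1 (one p)),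
    (coeFn_compress 0 (1 / 2) (one p)).trans (compressFun_ae_congr _ _ coeFn_one),
    (coeFn_compress (1 / 2) 1 (one p)).trans (compressFun_ae_congr _ _ coeFn_one),
    coeFn_one (p := p)] with t ht h2 h3 h4 h5
  rw [h2, Pi.add_apply, h3, h4, h5, compressFun, compressFun]
  by_cases h : t < 1 / 2
  · rw [indicator_of_mem (s := Ico (0 : ℝ) (1 / 2)) ⟨ht.1, h⟩,
      indicator_of_notMem (s := Ico (1 / 2 : ℝ) 1) fun h' => h.not_ge h'.1, add_zero]
  · rw [indicator_of_notMem (s := Ico (0 : ℝ) (1 / 2)) fun h' => h h'.2,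
      indicator_of_mem (s := Ico (1 / 2 : ℝ) 1) ⟨not_lt.1 h, ht.2⟩, zero_add]

/-- The two compressions have disjoint supports, so pointwise each is dominated by the sum. -/
lemma norm_le_norm_compress_add [Fact (1 ≤ p)] (f g : Lp01 p) :
    ‖compress p 0 (1 / 2) f‖ ≤ ‖compress p 0 (1 / 2) f + compress p (1 / 2) 1 g‖ ∧
    ‖compress p (1 / 2) 1 g‖ ≤ ‖compress p 0 (1 / 2) f + compress p (1 / 2) 1 g‖ := by
  constructor <;> refine Lp.norm_le_norm_of_ae_le ?_ <;>
  filter_upwards [Lp.coeFn_add (compress p 0 (1 / 2) f) (compress p (1 / 2) 1 g),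
    coeFn_compress 0 (1 / 2) f, coeFn_compress (1 / 2) 1 g] with t h2 h3 h4 <;>
  rw [h2, Pi.add_apply, h3, h4, compressFun, compressFun] <;>
  by_cases h : t < 1 / 2
  · rw [indicator_of_notMem (s := Ico (1 / 2 : ℝ) 1) fun h' => h.not_ge h'.1, add_zero]
  · rw [indicator_of_notMem (s := Ico (0 : ℝ) (1 / 2)) fun h' => h h'.2]
    simp
  · rw [indicator_of_notMem (s := Ico (1 / 2 : ℝ) 1) fun h' => h.not_ge h'.1]
    simp
  · rw [indicator_of_notMem (s := Ico (0 : ℝ) (1 / 2)) fun h' => h h'.2, zero_add]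

/-- The successor step of `R` takes no closure. The sum is still closed, because `(f, g) ↦
T_{[0,1/2)} f + T_{[1/2,1)} g` is bounded below and thus a closed embedding of the product. -/
lemma isClosed_map_compress_sup [Fact (1 ≤ p)] {S : Submodule ℝ (Lp01 p)}
    (hS : IsClosed (S : Set (Lp01 p))) :
    IsClosed ((S.map (compress p 0 (1 / 2)) ⊔ S.map (compress p (1 / 2) 1) :
      Submodule ℝ (Lp01 p)) : Set (Lp01 p)) := by
  obtain ⟨c, hc, h⟩ := norm_compress (p := p) (a := 0) (b := 1 / 2) le_rfl (by norm_num)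
    (by norm_num)
  obtain ⟨d, hd, h'⟩ := norm_compress (p := p) (a := 1 / 2) (b := 1) (by norm_num) (by norm_num)
    le_rfl
  let T : Lp01 p × Lp01 p →ₗ[ℝ] Lp01 p :=
    (compress p 0 (1 / 2)).coprod (compress p (1 / 2) 1)
  have hT : Continuous T :=
    ((compress_isClosedEmbedding le_rfl (by norm_num) (by norm_num)).continuous.comp
      continuous_fst).add ((compress_isClosedEmbedding (by norm_num) (by norm_num)
        le_rfl).continuous.comp continuous_snd)
  have h1 : AntilipschitzWith (Real.toNNReal (max c⁻¹ d⁻¹)) T :=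
    AddMonoidHomClass.antilipschitz_of_bound _ fun f => by
      have h2 := norm_le_norm_compress_add f.1 f.2
      rw [h, h'] at h2
      rw [Real.coe_toNNReal _ ((inv_pos.2 hc).le.trans (le_max_left _ _)), Prod.norm_def]
      refine max_le ?_ ?_
      · calc ‖f.1‖ = c⁻¹ * (c * ‖f.1‖) := (inv_mul_cancel_left₀ hc.ne' _).symm
          _ ≤ _ := mul_le_mul (le_max_left _ _) h2.1 (by positivity) (by positivity)
      · calc ‖f.2‖ = d⁻¹ * (d * ‖f.2‖) := (inv_mul_cancel_left₀ hd.ne' _).symm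
          _ ≤ _ := mul_le_mul (le_max_right _ _) h2.2 (by positivity) (by positivity)
  have h3 : S.map (compress p 0 (1 / 2)) ⊔ S.map (compress p (1 / 2) 1) = (S.prod S).map T := by
    rw [LinearMap.map_coprod_prod]
  rw [h3]
  have h4 : Topology.IsClosedEmbedding T :=
    h1.isClosedEmbedding (⟨T, hT⟩ : Lp01 p × Lp01 p →L[ℝ] Lp01 p).uniformContinuous
  exact h4.isClosedMap _ (hS.prod hS)

end Compress

/-! ## Dyadic intervals -/

lemma Dyadic.left_nonneg (I : Dyadic) : 0 ≤ I.left := by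
  rw [Dyadic.left]; positivity

lemma Dyadic.left_lt_right (I : Dyadic) : I.left < I.right := by
  rw [Dyadic.left, Dyadic.right]
  gcongr
  linarith

lemma Dyadic.right_le_one (I : Dyadic) : I.right ≤ 1 := by
  rw [Dyadic.right, div_le_one (by positivity)]
  exact_mod_cast I.idx.2

/-- For a dyadic interval of level `n + 1`, the doubled interval, translated to `[0, 1)`. -/
lemma Dyadic.exists_parent {n : ℕ} (J : Dyadic) (hJ : J.level = n + 1) :
    ∃ I : Dyadic, I.level = n ∧
      ((J.left = I.left / 2 ∧ J.right = I.right / 2) ∨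
        (J.left = 1 / 2 + I.left / 2 ∧ J.right = 1 / 2 + I.right / 2)) := by
  obtain ⟨m, i, hi⟩ := J
  obtain rfl : m = n + 1 := hJ
  rcases lt_or_ge i (2 ^ n) with h | h
  · refine ⟨⟨n, i, h⟩, rfl, Or.inl ?_⟩
    simp only [Dyadic.left, Dyadic.right, pow_succ]
    constructor <;> field_simp
  · refine ⟨⟨n, i - 2 ^ n, by rw [pow_succ] at hi; omega⟩, rfl, Or.inr ?_⟩
    simp only [Dyadic.left, Dyadic.right, pow_succ, Nat.cast_sub h]
    push_cast
    constructor <;> field_simp <;> ring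

lemma Dyadic.exists_left_child {n : ℕ} (I : Dyadic) (hI : I.level = n) :
    ∃ J : Dyadic, J.level = n + 1 ∧ J.left = I.left / 2 ∧ J.right = I.right / 2 := by
  obtain ⟨m, i, hi⟩ := I
  obtain rfl : m = n := hI
  refine ⟨⟨m + 1, i, by rw [pow_succ]; omega⟩, rfl, ?_⟩
  simp only [Dyadic.left, Dyadic.right, pow_succ]
  constructor <;> field_simp

lemma Dyadic.exists_right_child {n : ℕ} (I : Dyadic) (hI : I.level = n) :
    ∃ J : Dyadic, J.level = n + 1 ∧ J.left = 1 / 2 + I.left / 2 ∧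
      J.right = 1 / 2 + I.right / 2 := by
  obtain ⟨m, i, hi⟩ := I
  obtain rfl : m = n := hI
  refine ⟨⟨m + 1, 2 ^ m + i, by rw [pow_succ]; omega⟩, rfl, ?_⟩
  simp only [Dyadic.left, Dyadic.right, pow_succ]
  push_cast
  constructor <;> field_simp <;> ring

/-- The recursion for `R` applies the halving maps outermost, so a compression onto a dyadic
interval is factored through the half that contains it. -/
lemma dyadicCompress_of_left {p : ℝ≥0∞} {I J : Dyadic} (hl : J.left = I.left / 2)
    (hr : J.right = I.right / 2) :
    dyadicCompress p J = compress p 0 (1 / 2) ∘ₗ dyadicCompress p I := by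
  ext1 f
  rw [LinearMap.comp_apply, dyadicCompress, dyadicCompress,
    compress_compress (by norm_num) I.left_nonneg I.right_le_one, hl, hr]
  congr 2 <;> ring

lemma dyadicCompress_of_right {p : ℝ≥0∞} {I J : Dyadic} (hl : J.left = 1 / 2 + I.left / 2)
    (hr : J.right = 1 / 2 + I.right / 2) :
    dyadicCompress p J = compress p (1 / 2) 1 ∘ₗ dyadicCompress p I := by
  ext1 f
  rw [LinearMap.comp_apply, dyadicCompress, dyadicCompress,
    compress_compress (by norm_num) I.left_nonneg I.right_le_one, hl, hr]
  congr 2 <;> ring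

lemma dyadicCompress_isClosedEmbedding {p : ℝ≥0∞} [Fact (1 ≤ p)] (I : Dyadic) :
    Topology.IsClosedEmbedding (dyadicCompress p I) :=
  compress_isClosedEmbedding I.left_nonneg I.left_lt_right I.right_le_one

lemma topologicalClosure_map_of_isClosedEmbedding {p : ℝ≥0∞} [Fact (1 ≤ p)]
    {T : Lp01 p →ₗ[ℝ] Lp01 p} (hT : Topology.IsClosedEmbedding T) (S : Submodule ℝ (Lp01 p)) :
    (S.map T).topologicalClosure = S.topologicalClosure.map T :=
  SetLike.coe_injective (hT.isClosedMap.closure_image_eq_of_continuous hT.continuous _)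

section MeanZero

variable {p : ℝ≥0∞}

lemma dyadicSpace_le_iff {n : ℕ} {S : Submodule ℝ (Lp01 p)} :
    dyadicSpace p n ≤ S ↔ ∀ I : Dyadic, I.level = n → dyadicIndicator p I ∈ S := by
  rw [dyadicSpace, Submodule.span_le]
  constructor
  · exact fun h I hI => h ⟨I, hI, rfl⟩
  · rintro h _ ⟨I, hI, rfl⟩
    exact h I hI

/-- The image of `1` has the law of `1`, a point mass, and is therefore almost everywhere equal to
`1`. -/
lemma op_one (E : IndepEmbeddings p) {α β : Ordinal.{0}} (hα : Order.IsSuccLimit α) (h1 : α < ω₁) (hβ : β < α) :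
    E.op α β (one p) = one p := by
  have h2 := identDistrib_of_law_eq (E.dist_op α β hα h1 hβ (one p))
  apply Lp.ext
  have h3 : ∀ᵐ t ∂unitMeasure, E.op α β (one p) t = 1 :=
    h2.symm.ae_snd (measurableSet_singleton (1 : ℝ)) coeFn_one
  filter_upwards [h3, coeFn_one (p := p)] with t h4 h5
  rw [h4, h5]

variable [Fact (1 ≤ p)]

/-! ## The mean zero functions -/

lemma isClosed_meanZero : IsClosed (meanZero p : Set (Lp01 p)) := by
  have hp : (1 : ℝ≥0∞) ≤ p := Fact.out
  have h1 : ∀ f g : Lp01 p, ‖∫ t, f t ∂unitMeasure - ∫ t, g t ∂unitMeasure‖ ≤ ‖f - g‖ := by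
    intro f g
    have hi : ∀ f : Lp01 p, Integrable f unitMeasure := fun f => (Lp.memLp f).integrable hp
    have h3 : ∫ t, (f - g : Lp01 p) t ∂unitMeasure = ∫ t, f t - g t ∂unitMeasure :=
      integral_congr_ae (Lp.coeFn_sub f g)
    rw [← integral_sub (hi f) (hi g), ← h3]
    exact (norm_integral_le_integral_norm _).trans (integral_norm_le_norm _)
  have h2 : Continuous fun f : Lp01 p => ∫ t, f t ∂unitMeasure :=
    (LipschitzWith.of_dist_le_mul (K := 1) fun f g => by
      simpa [dist_eq_norm] using h1 f g).continuous
  exact isClosed_eq h2 continuous_const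

lemma span_one_sup_meanZero : Submodule.span ℝ {one p} ⊔ meanZero p = ⊤ := by
  have hp : (1 : ℝ≥0∞) ≤ p := Fact.out
  refine eq_top_iff.2 fun f _ => ?_
  set c := ∫ t, f t ∂unitMeasure with hc
  rw [← add_sub_cancel (c • one p) f]
  refine Submodule.add_mem_sup (Submodule.smul_mem _ _ (Submodule.mem_span_singleton_self _)) ?_
  change ∫ t, _ ∂_ = 0
  have h1 : (f - c • one p : Lp01 p) =ᵐ[unitMeasure] fun t => f t - c := by
    filter_upwards [Lp.coeFn_sub f (c • one p), Lp.coeFn_smul c (one p), coeFn_one (p := p)]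
      with t h1 h2 h3
    rw [h1, Pi.sub_apply, h2, Pi.smul_apply, h3, smul_eq_mul, mul_one]
  rw [integral_congr_ae h1, integral_sub ((Lp.memLp f).integrable hp) (integrable_const c), ← hc]
  simp

lemma span_one_inf_meanZero : Submodule.span ℝ {one p} ⊓ meanZero p = ⊥ := by
  rw [Submodule.eq_bot_iff]
  rintro _ ⟨hf, h0⟩
  obtain ⟨c, rfl⟩ := Submodule.mem_span_singleton.1 hf
  by_cases hc : c = 0
  · rw [hc, zero_smul]
  · exact absurd ((Submodule.smul_mem_iff _ hc).1 h0) one_notMem_meanZero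

/-- The modular law. -/
lemma sup_inf_meanZero {A M : Submodule ℝ (Lp01 p)} (hM : M ≤ meanZero p) :
    (A ⊔ M) ⊓ meanZero p = A ⊓ meanZero p ⊔ M := by
  rw [sup_comm, sup_inf_assoc_of_le A hM, sup_comm]

/-! ## The spaces `R_α^p` -/

section Spaces

variable (E : IndepEmbeddings p)

lemma R_zero : R E 0 = Submodule.span ℝ {one p} := by
  rw [R, Ordinal.limitRecOn_zero]
  rfl

lemma R_add_one (α : Ordinal.{0}) : R E (α + 1) =
    (R E α).map (compress p 0 (1 / 2)) ⊔ (R E α).map (compress p (1 / 2) 1) := by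
  rw [R, Ordinal.limitRecOn_add_one]
  rfl

lemma R_limit {α : Ordinal.{0}} (hα : Order.IsSuccLimit α) : R E α =
    (⨆ (β : Ordinal.{0}) (_ : β < α), (R E β).map (E.op α β)).topologicalClosure := by
  rw [R, Ordinal.limitRecOn_limit _ _ _ _ hα]
  rfl

lemma isClosed_R (α : Ordinal.{0}) : IsClosed (R E α : Set (Lp01 p)) := by
  induction α using Ordinal.limitRecOn with
  | zero =>
    rw [R_zero]
    exact Submodule.closed_of_finiteDimensional _
  | add_one α ih =>
    rw [R_add_one]
    exact isClosed_map_compress_sup ih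
  | limit α hα _ =>
    rw [R_limit E hα]
    exact Submodule.isClosed_topologicalClosure _

lemma isClosed_R0 (α : Ordinal.{0}) : IsClosed (R0 E α : Set (Lp01 p)) :=
  (isClosed_R E α).inter isClosed_meanZero

lemma op_mem_meanZero {α β : Ordinal.{0}} (hα : Order.IsSuccLimit α) (h1 : α < ω₁) (hβ : β < α)
    {f : Lp01 p} (hf : f ∈ meanZero p) : E.op α β f ∈ meanZero p :=
  (integral_eq_of_law_eq (E.dist_op α β hα h1 hβ f)).trans hf

lemma op_isClosedEmbedding {α β : Ordinal.{0}} (hα : Order.IsSuccLimit α) (h1 : α < ω₁)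
    (hβ : β < α) : Topology.IsClosedEmbedding (E.op α β) :=
  (isometry_of_law_eq (E.dist_op α β hα h1 hβ)).isClosedEmbedding

lemma one_mem_R {α : Ordinal.{0}} (h : α < ω₁) : one p ∈ R E α := by
  induction α using Ordinal.limitRecOn with
  | zero =>
    rw [R_zero]
    exact Submodule.mem_span_singleton_self _
  | add_one α ih =>
    have h1 := ih (lt_of_le_of_lt (by simp) h)
    rw [R_add_one, ← compress_one_add]
    exact Submodule.add_mem_sup (Submodule.mem_map_of_mem h1) (Submodule.mem_map_of_mem h1)
  | limit α hα ih =>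
    rw [R_limit E hα]
    apply Submodule.le_topologicalClosure
    have h0 : (0 : Ordinal.{0}) < α := hα.bot_lt
    refine Submodule.mem_iSup_of_mem 0 (Submodule.mem_iSup_of_mem h0 ?_)
    exact ⟨one p, ih 0 h0 (h0.trans h), op_one E hα h h0⟩

lemma R_eq_sup {α : Ordinal.{0}} (h : α < ω₁) :
    R E α = Submodule.span ℝ {one p} ⊔ R0 E α := by
  have h1 : Submodule.span ℝ {one p} ≤ R E α := by
    rw [Submodule.span_singleton_le_iff_mem]
    exact one_mem_R E h
  rw [R0, inf_comm, ← sup_inf_assoc_of_le _ h1, span_one_sup_meanZero, top_inf_eq]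

lemma R0_zero : R0 E 0 = ⊥ := by
  rw [R0, R_zero, span_one_inf_meanZero]

lemma R_add_nat (ξ : Ordinal.{0}) (n : ℕ) : R E (ξ + n) =
    ⨆ (I : Dyadic) (_ : I.level = n), (R E ξ).map (dyadicCompress p I) := by
  induction n with
  | zero =>
    rw [Nat.cast_zero, add_zero]
    have h1 : ∀ I : Dyadic, I.level = 0 → dyadicCompress p I = LinearMap.id := by
      rintro ⟨m, i, hi⟩ hm
      obtain rfl : m = 0 := hm
      obtain rfl : i = 0 := by simpa using hi
      ext1 f
      simpa [dyadicCompress, Dyadic.left, Dyadic.right] using compress_zero_one f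
    apply le_antisymm
    · refine le_iSup₂_of_le ⟨0, 0⟩ rfl ?_
      rw [h1 _ rfl, Submodule.map_id]
    · refine iSup₂_le fun I hI => ?_
      rw [h1 _ hI, Submodule.map_id]
  | succ n ih =>
    rw [Nat.cast_add, Nat.cast_one, ← add_assoc, R_add_one, ih]
    simp only [Submodule.map_iSup, ← Submodule.map_comp]
    apply le_antisymm
    · refine sup_le (iSup₂_le fun I hI => ?_) (iSup₂_le fun I hI => ?_)
      · obtain ⟨J, hJ, hl, hr⟩ := I.exists_left_child hI
        refine le_iSup₂_of_le J hJ ?_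
        rw [dyadicCompress_of_left hl hr]
      · obtain ⟨J, hJ, hl, hr⟩ := I.exists_right_child hI
        refine le_iSup₂_of_le J hJ ?_
        rw [dyadicCompress_of_right hl hr]
    · refine iSup₂_le fun J hJ => ?_
      obtain ⟨I, hI, ⟨hl, hr⟩ | ⟨hl, hr⟩⟩ := J.exists_parent hJ
      · refine le_sup_of_le_left (le_iSup₂_of_le I hI ?_)
        rw [dyadicCompress_of_left hl hr]
      · refine le_sup_of_le_right (le_iSup₂_of_le I hI ?_)
        rw [dyadicCompress_of_right hl hr]

/-- In `T_I(R_ξ)` the constants contribute the multiples of `χ_I` and the rest has mean zero. By the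
modular law, only the span of the `χ_I` has to be cut down to mean zero. -/
lemma R0_add_nat {ξ : Ordinal.{0}} (h : ξ < ω₁) (n : ℕ) : R0 E (ξ + n) =
    dyadicSpace0 p n ⊔
      ⨆ (I : Dyadic) (_ : I.level = n), (R0 E ξ).map (dyadicCompress p I) := by
  set M := ⨆ (I : Dyadic) (_ : I.level = n), (R0 E ξ).map (dyadicCompress p I) with hM
  have hM0 : M ≤ meanZero p := by
    refine iSup₂_le fun I hI => ?_
    rintro _ ⟨f, hf, rfl⟩
    exact compress_mem_meanZero I.left_nonneg I.left_lt_right I.right_le_one hf.2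
  rw [dyadicSpace0, ← sup_inf_meanZero hM0, R0, R_add_nat]
  congr 1
  apply le_antisymm
  · refine iSup₂_le fun I hI => ?_
    rw [R_eq_sup E h, Submodule.map_sup, Submodule.map_span, image_singleton, dyadicCompress_one]
    refine sup_le_sup ?_ (le_iSup₂_of_le I hI le_rfl)
    rw [Submodule.span_singleton_le_iff_mem]
    exact dyadicSpace_le_iff.1 le_rfl I hI
  · refine sup_le (dyadicSpace_le_iff.2 fun I hI => ?_)
      (iSup₂_mono fun I _ => Submodule.map_mono inf_le_left)
    refine Submodule.mem_iSup_of_mem I (Submodule.mem_iSup_of_mem hI ?_)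
    exact ⟨one p, one_mem_R E h, dyadicCompress_one I⟩

/-- All the `T_β^α` send constants to the same constants, so `R_α` is that line plus the closed span
of the mean zero parts. The sum is closed since the line is finite-dimensional. -/
lemma R0_limit {α : Ordinal.{0}} (hα : Order.IsSuccLimit α) (h : α < ω₁) : R0 E α =
    (⨆ (β : Ordinal.{0}) (_ : β < α), (R0 E β).map (E.op α β)).topologicalClosure := by
  set M := ⨆ (β : Ordinal.{0}) (_ : β < α), (R0 E β).map (E.op α β) with hM
  have hM0 : M.topologicalClosure ≤ meanZero p := by
    refine Submodule.topologicalClosure_minimal _ (iSup₂_le fun β hβ => ?_) isClosed_meanZero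
    rintro _ ⟨f, hf, rfl⟩
    exact op_mem_meanZero E hα h hβ hf.2
  have h1 : R E α = Submodule.span ℝ {one p} ⊔ M.topologicalClosure := by
    apply le_antisymm
    · rw [R_limit E hα]
      refine Submodule.topologicalClosure_minimal _ (iSup₂_le fun β hβ => ?_) ?_
      · rw [R_eq_sup E (hβ.trans h), Submodule.map_sup, Submodule.map_span, image_singleton,
          op_one E hα h hβ]
        exact sup_le_sup le_rfl ((le_iSup₂_of_le β hβ le_rfl).trans M.le_topologicalClosure)
      · rw [sup_comm]
        exact Submodule.isClosed_sup_finiteDimensional _ _ M.isClosed_topologicalClosure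
    · refine sup_le ?_ ?_
      · rw [Submodule.span_singleton_le_iff_mem]
        exact one_mem_R E h
      · rw [R_limit E hα]
        exact Submodule.topologicalClosure_mono
          (iSup₂_mono fun β _ => Submodule.map_mono inf_le_left)
  rw [R0, h1, sup_inf_meanZero hM0, span_one_inf_meanZero, bot_sup_eq]

end Spaces

end MeanZero

/-! ## The trees -/

lemma intPart_limit {α : Ordinal.{0}} (hα : Order.IsSuccLimit α) : intPart α = 0 :=
  Ordinal.limitRecOn_limit _ _ _ _ hα

lemma limitPart_add_intPart (α : Ordinal.{0}) : limitPart α + intPart α = α :=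
  (limitPart_spec α).2

lemma limitPart_lt {α : Ordinal.{0}} (hα : 0 < intPart α) : limitPart α < α := by
  conv_rhs => rw [← limitPart_add_intPart α]
  exact lt_add_of_pos_right _ (by exact_mod_cast hα)

lemma eq_zero_or_limit_or_intPart_pos (α : Ordinal.{0}) :
    α = 0 ∨ Order.IsSuccLimit α ∨ 0 < intPart α := by
  rcases Nat.eq_zero_or_pos (intPart α) with h | h
  · have h1 := limitPart_spec α
    rw [h, Nat.cast_zero, add_zero] at h1
    rw [h1.2] at h1
    tauto
  · exact Or.inr (Or.inr h)

lemma InTree.exists_eq_cons {α : Ordinal.{0}} {l : List Entry} (h : InTree α l) :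
    ∃ t, l = Entry.ord α :: t := by
  cases h with
  | limit hα hβ hβα hμ => exact ⟨_, rfl⟩
  | top hα => exact ⟨_, rfl⟩
  | step hα hI hμ => exact ⟨_, rfl⟩

lemma InTree.singleton_prefix {α : Ordinal.{0}} {l : List Entry} (h : InTree α l) :
    [Entry.ord α] <+: l := by
  obtain ⟨t, rfl⟩ := h.exists_eq_cons
  exact ⟨t, rfl⟩

/-- A member of `𝒯_α` starts with `α`, so a sequence determines its tree. In a limit tree, this
forces comparable members to come from the same `β`. -/
lemma InTree.eq_of_prefix {α β : Ordinal.{0}} {l m : List Entry} (hl : InTree α l)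
    (hm : InTree β m) (h : l <+: m) : α = β := by
  obtain ⟨s, rfl⟩ := hl.exists_eq_cons
  obtain ⟨t, rfl⟩ := hm.exists_eq_cons
  simpa using (List.cons_prefix_cons.1 h).1

lemma not_inTree_zero (l : List Entry) : ¬ InTree 0 l := by
  intro h
  cases h with
  | limit hα hβ hβα hμ => exact not_lt_bot hβα
  | top hα => simp [intPart] at hα
  | step hα hI hμ => simp [intPart] at hα

lemma InTree.exists_of_limit {α : Ordinal.{0}} {l : List Entry} (h : InTree α l)
    (hα : Order.IsSuccLimit α) :
    ∃ β μ, 1 ≤ β ∧ β < α ∧ InTree β μ ∧ l = Entry.ord α :: μ := by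
  cases h with
  | limit _ hβ hβα hμ => exact ⟨_, _, hβ, hβα, hμ, rfl⟩
  | top h0 => exact absurd (intPart_limit hα) h0.ne'
  | step h0 => exact absurd (intPart_limit hα) h0.ne'

lemma InTree.eq_or_exists_of_intPart_pos {α : Ordinal.{0}} {l : List Entry} (h : InTree α l)
    (hα : 0 < intPart α) : l = [Entry.ord α] ∨ ∃ I μ, I.level = intPart α ∧
      InTree (limitPart α) μ ∧ l = Entry.ord α :: Entry.dyad I :: μ := by
  cases h with
  | limit h0 => exact absurd (intPart_limit h0) hα.ne'
  | top => exact Or.inl rfl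
  | step _ hI hμ => exact Or.inr ⟨_, _, hI, hμ, rfl⟩

lemma InTree.lastOrd_cons {α : Ordinal.{0}} {l : List Entry} (h : InTree α l) (e : Entry) :
    lastOrd (e :: l) = lastOrd l := by
  obtain ⟨t, rfl⟩ := h.exists_eq_cons
  simp [lastOrd, List.getLast?_cons_cons]

lemma base_add_kappa (l : List Entry) : base l + kappa l = lastOrd l :=
  limitPart_add_intPart _

/-! ## Roots -/

lemma IsRoot.eq_of_intPart_pos {α : Ordinal.{0}} {l : List Entry} (h : IsRoot α l)
    (hα : 0 < intPart α) : l = [Entry.ord α] :=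
  (h.2 _ (InTree.top hα) h.1.singleton_prefix).symm

lemma IsRoot.exists_of_limit {α : Ordinal.{0}} {l : List Entry} (h : IsRoot α l)
    (hα : Order.IsSuccLimit α) :
    ∃ β μ, 1 ≤ β ∧ β < α ∧ IsRoot β μ ∧ l = Entry.ord α :: μ := by
  obtain ⟨β, μ, hβ, hβα, hμ, rfl⟩ := h.1.exists_of_limit hα
  refine ⟨β, μ, hβ, hβα, ⟨hμ, fun m hm hmμ => ?_⟩, rfl⟩
  have h1 := h.2 _ (InTree.limit hα hβ hβα hm) (List.cons_prefix_cons.2 ⟨rfl, hmμ⟩)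
  exact (List.cons_injective h1)

lemma InTree.exists_root {α : Ordinal.{0}} {l : List Entry} (h : InTree α l) :
    ∃ r, IsRoot α r ∧ r <+: l := by
  have htop : ∀ {α : Ordinal.{0}} {l : List Entry}, InTree α l → 0 < intPart α →
      ∃ r, IsRoot α r ∧ r <+: l := fun {α l} h hα =>
    ⟨[Entry.ord α], ⟨InTree.top hα, fun m hm hmr =>
      hmr.eq_of_length_le hm.singleton_prefix.length_le⟩, h.singleton_prefix⟩
  induction h with
  | @limit α β μ hα hβ hβα hμ ih =>
    obtain ⟨r, hr, hrμ⟩ := ih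
    refine ⟨Entry.ord α :: r, ⟨InTree.limit hα hβ hβα hr.1, fun m hm hmr => ?_⟩,
      List.cons_prefix_cons.2 ⟨rfl, hrμ⟩⟩
    obtain ⟨β', ν, -, -, hν, rfl⟩ := hm.exists_of_limit hα
    have h1 := (List.cons_prefix_cons.1 hmr).2
    obtain rfl := hν.eq_of_prefix hr.1 h1
    rw [hr.2 _ hν h1]
  | top hα => exact htop (InTree.top hα) hα
  | step hα hI hμ => exact htop (InTree.step hα hI hμ) hα

/-! ## Operators and spaces indexed over the trees -/

section TreeSpaces

variable {p : ℝ≥0∞} (E : IndepEmbeddings p)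

lemma treeOp_limit (α : Ordinal.{0}) {β : Ordinal.{0}} {μ : List Entry} (h : InTree β μ) :
    treeOp E (Entry.ord α :: μ) = E.op α β ∘ₗ treeOp E μ := by
  obtain ⟨t, rfl⟩ := h.exists_eq_cons
  rw [treeOp]

lemma treeOp_step (α : Ordinal.{0}) (I : Dyadic) (μ : List Entry) :
    treeOp E (Entry.ord α :: Entry.dyad I :: μ) = dyadicCompress p I ∘ₗ treeOp E μ := by
  rw [treeOp]

/-- A root ends at the first successor ordinal met, before any compression, so its operator is
composed of the maps `T_β^α` and the identity only. -/
lemma law_treeOp_root {α : Ordinal.{0}} (hα : α < ω₁) {l : List Entry} (h : IsRoot α l)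
    (f : Lp01 p) : law (treeOp E l f) = law f := by
  induction α using WellFoundedLT.induction generalizing l with
  | ind α ih =>
    rcases eq_zero_or_limit_or_intPart_pos α with rfl | hl | h0
    · exact absurd h.1 (not_inTree_zero l)
    · obtain ⟨β, μ, -, hβα, hμ, rfl⟩ := h.exists_of_limit hl
      rw [treeOp_limit E α hμ.1, LinearMap.comp_apply, E.dist_op α β hl hα hβα,
        ih β hβα (hβα.trans hα) hμ]
    · rw [h.eq_of_intPart_pos h0, treeOp, LinearMap.id_apply]

variable [Fact (1 ≤ p)]

lemma X_limit (α : Ordinal.{0}) {β : Ordinal.{0}} {μ : List Entry} (h : InTree β μ) :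
    X E (Entry.ord α :: μ) = (X E μ).map (E.op α β) := by
  rw [X, X, treeOp_limit E α h, kappa, kappa, h.lastOrd_cons, Submodule.map_comp]

lemma X_step (α : Ordinal.{0}) {ξ : Ordinal.{0}} (I : Dyadic) {μ : List Entry} (h : InTree ξ μ) :
    X E (Entry.ord α :: Entry.dyad I :: μ) = (X E μ).map (dyadicCompress p I) := by
  have h1 : lastOrd (Entry.ord α :: Entry.dyad I :: μ) = lastOrd μ := by
    rw [← h.lastOrd_cons (Entry.dyad I)]
    simp [lastOrd, List.getLast?_cons_cons]
  rw [X, X, treeOp_step, kappa, kappa, h1, Submodule.map_comp]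

lemma X_top (α : Ordinal.{0}) : X E [Entry.ord α] = dyadicSpace0 p (intPart α) := by
  rw [X, treeOp, Submodule.map_id]
  simp [kappa, lastOrd]

/-- The linear span of the `X_m` with `m ∈ 𝒯_α` extending `l`. -/
def treeSpan (α : Ordinal.{0}) (l : List Entry) : Submodule ℝ (Lp01 p) :=
  ⨆ (m : List Entry) (_ : InTree α m) (_ : l <+: m), X E m

lemma Y_eq (α : Ordinal.{0}) (l : List Entry) :
    Y E α l = (treeSpan E α l).topologicalClosure := rfl

lemma X_le_treeSpan {α : Ordinal.{0}} {l m : List Entry} (hm : InTree α m) (hlm : l <+: m) :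
    X E m ≤ treeSpan E α l :=
  le_iSup_of_le m (le_iSup₂_of_le hm hlm le_rfl)

lemma treeSpan_le {α : Ordinal.{0}} {l : List Entry} {S : Submodule ℝ (Lp01 p)}
    (h : ∀ m, InTree α m → l <+: m → X E m ≤ S) : treeSpan E α l ≤ S :=
  iSup_le fun m => iSup₂_le fun hm hlm => h m hm hlm

lemma map_treeSpan_le {α : Ordinal.{0}} {l : List Entry} {S : Submodule ℝ (Lp01 p)}
    {T : Lp01 p →ₗ[ℝ] Lp01 p} (h : ∀ m, InTree α m → l <+: m → (X E m).map T ≤ S) :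
    (treeSpan E α l).map T ≤ S := by
  rw [Submodule.map_le_iff_le_comap]
  exact treeSpan_le E fun m hm hlm => Submodule.map_le_iff_le_comap.1 (h m hm hlm)

lemma treeSpan_singleton (α : Ordinal.{0}) : treeSpan E α [Entry.ord α] = treeSpan E α [] :=
  le_antisymm (treeSpan_le E fun _ hm _ => X_le_treeSpan E hm List.nil_prefix)
    (treeSpan_le E fun _ hm _ => X_le_treeSpan E hm hm.singleton_prefix)

lemma treeSpan_nil_limit {α : Ordinal.{0}} (hα : Order.IsSuccLimit α) : treeSpan E α [] =
    ⨆ (β : Ordinal.{0}) (_ : 1 ≤ β ∧ β < α), (treeSpan E β []).map (E.op α β) := by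
  apply le_antisymm
  · refine treeSpan_le E fun m hm _ => ?_
    obtain ⟨β, μ, hβ, hβα, hμ, rfl⟩ := hm.exists_of_limit hα
    refine le_iSup₂_of_le β ⟨hβ, hβα⟩ ?_
    rw [X_limit E α hμ]
    exact Submodule.map_mono (X_le_treeSpan E hμ List.nil_prefix)
  · refine iSup₂_le fun β hβ => map_treeSpan_le E fun m hm _ => ?_
    rw [← X_limit E α hm]
    exact X_le_treeSpan E (InTree.limit hα hβ.1 hβ.2 hm) List.nil_prefix

lemma treeSpan_nil_succ {α : Ordinal.{0}} (hα : 0 < intPart α) : treeSpan E α [] =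
    dyadicSpace0 p (intPart α) ⊔ ⨆ (I : Dyadic) (_ : I.level = intPart α),
      (treeSpan E (limitPart α) []).map (dyadicCompress p I) := by
  apply le_antisymm
  · refine treeSpan_le E fun m hm _ => ?_
    rcases hm.eq_or_exists_of_intPart_pos hα with rfl | ⟨I, μ, hI, hμ, rfl⟩
    · rw [X_top]
      exact le_sup_left
    · refine le_sup_of_le_right (le_iSup₂_of_le I hI ?_)
      rw [X_step E α I hμ]
      exact Submodule.map_mono (X_le_treeSpan E hμ List.nil_prefix)
  · refine sup_le ?_ (iSup₂_le fun I hI => map_treeSpan_le E fun m hm _ => ?_)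
    · rw [← X_top E]
      exact X_le_treeSpan E (InTree.top hα) List.nil_prefix
    · rw [← X_step E α I hm]
      exact X_le_treeSpan E (InTree.step hα hI hm) List.nil_prefix

lemma treeSpan_cons_limit {α β : Ordinal.{0}} (hα : Order.IsSuccLimit α) (hβ : 1 ≤ β)
    (hβα : β < α) {μ : List Entry} (hμ : InTree β μ) :
    treeSpan E α (Entry.ord α :: μ) = (treeSpan E β μ).map (E.op α β) := by
  apply le_antisymm
  · refine treeSpan_le E fun m hm hlm => ?_
    obtain ⟨β', ν, -, -, hν, rfl⟩ := hm.exists_of_limit hα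
    have h1 := (List.cons_prefix_cons.1 hlm).2
    obtain rfl := hμ.eq_of_prefix hν h1
    rw [X_limit E α hν]
    exact Submodule.map_mono (X_le_treeSpan E hν h1)
  · refine map_treeSpan_le E fun m hm hlm => ?_
    rw [← X_limit E α hm]
    exact X_le_treeSpan E (InTree.limit hα hβ hβα hm) (List.cons_prefix_cons.2 ⟨rfl, hlm⟩)

lemma treeSpan_cons_step {α : Ordinal.{0}} {I : Dyadic} (hα : 0 < intPart α)
    (hI : I.level = intPart α) (μ : List Entry) :
    treeSpan E α (Entry.ord α :: Entry.dyad I :: μ) =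
      (treeSpan E (limitPart α) μ).map (dyadicCompress p I) := by
  apply le_antisymm
  · refine treeSpan_le E fun m hm hlm => ?_
    rcases hm.eq_or_exists_of_intPart_pos hα with rfl | ⟨J, ν, hJ, hν, rfl⟩
    · simpa using hlm.length_le
    · have h1 := (List.cons_prefix_cons.1 hlm).2
      have h2 := List.cons_prefix_cons.1 h1
      obtain rfl : I = J := by simpa using h2.1
      rw [X_step E α I hν]
      exact Submodule.map_mono (X_le_treeSpan E hν h2.2)
  · refine map_treeSpan_le E fun m hm hlm => ?_
    rw [← X_step E α I hm]
    exact X_le_treeSpan E (InTree.step hα hI hm)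
      (List.cons_prefix_cons.2 ⟨rfl, List.cons_prefix_cons.2 ⟨rfl, hlm⟩⟩)

/-- `R_α^{p,0}` is the closed linear span of all the `X_m`, `m ∈ 𝒯_α`. -/
lemma R0_eq_topologicalClosure {α : Ordinal.{0}} (hα : α < ω₁) :
    R0 E α = (treeSpan E α []).topologicalClosure := by
  induction α using WellFoundedLT.induction with
  | ind α ih =>
    rcases eq_zero_or_limit_or_intPart_pos α with rfl | hl | h0
    · have h1 : treeSpan E 0 [] = ⊥ :=
        le_bot_iff.1 (treeSpan_le E fun m hm _ => absurd hm (not_inTree_zero m))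
      rw [h1, R0_zero, (Submodule.closed_of_finiteDimensional _).submodule_topologicalClosure_eq]
    · rw [R0_limit E hl hα, treeSpan_nil_limit E hl]
      apply le_antisymm
      · refine Submodule.topologicalClosure_minimal _ (iSup₂_le fun β hβ => ?_)
          (Submodule.isClosed_topologicalClosure _)
        -- The recursion for `R` includes `β = 0` and the tree does not; nothing is lost because
        -- `R_0^0 = 0`.
        rcases eq_or_ne β 0 with rfl | hβ0
        · rw [R0_zero, Submodule.map_bot]
          exact bot_le
        · rw [ih β hβ (hβ.trans hα), ← topologicalClosure_map_of_isClosedEmbedding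
            (op_isClosedEmbedding E hl hα hβ)]
          exact Submodule.topologicalClosure_mono
            (le_iSup₂_of_le β ⟨Order.one_le_iff_pos.2 (pos_iff_ne_zero.2 hβ0), hβ⟩ le_rfl)
      · refine Submodule.topologicalClosure_mono (iSup₂_le fun β hβ => ?_)
        refine le_iSup₂_of_le β hβ.2 (Submodule.map_mono ?_)
        rw [ih β hβ.2 (hβ.2.trans hα)]
        exact Submodule.le_topologicalClosure _
    · have hlt := limitPart_lt h0
      have h1 := R0_add_nat E (hlt.trans hα) (intPart α)
      rw [limitPart_add_intPart] at h1
      apply le_antisymm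
      · rw [h1, treeSpan_nil_succ E h0]
        refine sup_le (le_sup_left.trans (Submodule.le_topologicalClosure _))
          (iSup₂_le fun I hI => ?_)
        rw [ih _ hlt (hlt.trans hα), ← topologicalClosure_map_of_isClosedEmbedding
          (dyadicCompress_isClosedEmbedding I)]
        exact Submodule.topologicalClosure_mono
          (le_sup_of_le_right (le_iSup₂_of_le I hI le_rfl))
      · refine Submodule.topologicalClosure_minimal _ ?_ (isClosed_R0 E α)
        rw [h1, treeSpan_nil_succ E h0]
        refine sup_le_sup le_rfl (iSup₂_mono fun I _ => Submodule.map_mono ?_)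
        rw [ih _ hlt (hlt.trans hα)]
        exact Submodule.le_topologicalClosure _

/-- Prepending entries to a member applies one closed embedding to both sides. The induction starts
at `(α)`, which every member of `𝒯_α` extends, so there the claim is `R0_eq_topologicalClosure`. -/
lemma map_treeOp_R0 {α : Ordinal.{0}} (hα : α < ω₁) {l : List Entry} (h : InTree α l) :
    (R0 E (lastOrd l)).map (treeOp E l) = Y E α l := by
  induction h with
  | @limit α β μ hl hβ hβα hμ ih =>
    rw [hμ.lastOrd_cons, treeOp_limit E α hμ, Submodule.map_comp, ih (hβα.trans hα), Y_eq, Y_eq,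
      treeSpan_cons_limit E hl hβ hβα hμ,
      topologicalClosure_map_of_isClosedEmbedding (op_isClosedEmbedding E hl hα hβα)]
  | @top α h0 =>
    rw [treeOp, Submodule.map_id, Y_eq, treeSpan_singleton, ← R0_eq_topologicalClosure E hα]
    simp [lastOrd]
  | @step α I μ h0 hI hμ ih =>
    have h1 : lastOrd (Entry.ord α :: Entry.dyad I :: μ) = lastOrd μ := by
      rw [← hμ.lastOrd_cons (Entry.dyad I)]
      simp [lastOrd, List.getLast?_cons_cons]
    rw [h1, treeOp_step, Submodule.map_comp, ih ((limitPart_lt h0).trans hα), Y_eq, Y_eq,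
      treeSpan_cons_step E h0 hI,
      topologicalClosure_map_of_isClosedEmbedding (dyadicCompress_isClosedEmbedding I)]

/-- Roots are given by an injective labelling `r` on an arbitrary index set, so that the inductive
step keeps the indices and replaces each root by its tail. -/
lemma cf_sum_of_roots {α : Ordinal.{0}} (hα : α < ω₁) {ι : Type 1} (s : Finset ι)
    {r : ι → List Entry} {f : ι → Lp01 p} (hinj : InjOn r s) (hr : ∀ i ∈ s, IsRoot α (r i))
    (hf : ∀ i ∈ s, f i ∈ Y E α (r i)) : cf (∑ i ∈ s, f i) = ∏ i ∈ s, cf (f i) := by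
  classical
  induction α using WellFoundedLT.induction generalizing ι with
  | ind α ih =>
    rcases eq_zero_or_limit_or_intPart_pos α with rfl | hl | h0
    · obtain rfl : s = ∅ := Finset.eq_empty_of_forall_notMem fun i hi =>
        not_inTree_zero _ (hr i hi).1
      simp [cf_zero]
    · have h1 : ∀ i, ∃ (b : Iio α) (m : List Entry) (g : Lp01 p), i ∈ s →
          r i = Entry.ord α :: m ∧ IsRoot b m ∧ g ∈ Y E b m ∧ E.op α b g = f i := by
        intro i
        by_cases hi : i ∈ s
        · obtain ⟨β, m, hβ, hβα, hm, hrm⟩ := (hr i hi).exists_of_limit hl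
          have h2 := hf i hi
          rw [hrm, Y_eq, treeSpan_cons_limit E hl hβ hβα hm.1,
            topologicalClosure_map_of_isClosedEmbedding (op_isClosedEmbedding E hl hα hβα)] at h2
          obtain ⟨g, hg, hgf⟩ := h2
          exact ⟨⟨β, hβα⟩, m, g, fun _ => ⟨hrm, hm, hg, hgf⟩⟩
        · exact ⟨⟨0, hl.bot_lt⟩, [], 0, fun h => absurd h hi⟩
      choose b m g h using h1
      have hmaps : ∀ i ∈ s, b i ∈ s.image b := fun i hi => Finset.mem_image_of_mem b hi
      have h2 : ∑ i ∈ s, f i =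
          ∑ β ∈ s.image b, E.op α β (∑ i ∈ s with b i = β, g i) := by
        rw [← Finset.sum_fiberwise_of_maps_to hmaps]
        refine Finset.sum_congr rfl fun β _ => ?_
        rw [map_sum]
        refine Finset.sum_congr rfl fun i hi => ?_
        obtain ⟨his, rfl⟩ := Finset.mem_filter.1 hi
        exact (h i his).2.2.2.symm
      -- Distinct `β` give independent partial sums. Within one `β` the operator preserves laws and
      -- is dropped, and the induction hypothesis factors what remains.
      rw [h2, cf_finset_sum (E.indep_op α hl hα fun β => ∑ i ∈ s with b i = β, g i),
        ← Finset.prod_fiberwise_of_maps_to hmaps]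
      refine Finset.prod_congr rfl fun β _ => ?_
      rw [cf_eq_of_law_eq (E.dist_op α β hl hα β.2 _),
        ih β β.2 (lt_trans β.2 hα) (r := m)]
      · refine Finset.prod_congr rfl fun i hi => ?_
        obtain ⟨his, rfl⟩ := Finset.mem_filter.1 hi
        rw [← (h i his).2.2.2, cf_eq_of_law_eq (E.dist_op α (b i) hl hα (b i).2 _)]
      · intro i hi j hj hij
        have hi := (Finset.mem_filter.1 hi).1
        have hj := (Finset.mem_filter.1 hj).1
        exact hinj hi hj (by rw [(h i hi).1, (h j hj).1, hij])
      · intro i hi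
        obtain ⟨his, rfl⟩ := Finset.mem_filter.1 hi
        exact (h i his).2.1
      · intro i hi
        obtain ⟨his, rfl⟩ := Finset.mem_filter.1 hi
        exact (h i his).2.2.1
    -- At a successor `(α)` is the only root, so there is at most one summand.
    · have h1 : s.card ≤ 1 := Finset.card_le_one.2 fun i hi j hj => hinj hi hj (by
        rw [(hr i hi).eq_of_intPart_pos h0, (hr j hj).eq_of_intPart_pos h0])
      rcases Nat.le_one_iff_eq_zero_or_eq_one.1 h1 with h2 | h2
      · simp [Finset.card_eq_zero.1 h2, cf_zero]
      · obtain ⟨i, rfl⟩ := Finset.card_eq_one.1 h2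
        simp

lemma indepSpaces_roots {α : Ordinal.{0}} (hα : α < ω₁) :
    IndepSpaces (fun l : Root α => Y E α l) :=
  indepSpaces_of_cf fun s _ hf => cf_sum_of_roots E hα s Subtype.val_injective.injOn
    (fun l _ => l.2) fun l _ => hf l

lemma R0_eq_closure_roots {α : Ordinal.{0}} (hα : α < ω₁) :
    R0 E α = (⨆ l : Root α, Y E α l).topologicalClosure := by
  rw [R0_eq_topologicalClosure E hα]
  apply le_antisymm
  · refine Submodule.topologicalClosure_mono (treeSpan_le E fun m hm _ => ?_)
    obtain ⟨r, hr, hrm⟩ := hm.exists_root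
    refine le_iSup_of_le ⟨r, hr⟩ ?_
    exact (X_le_treeSpan E hm hrm).trans (Submodule.le_topologicalClosure _)
  · refine Submodule.topologicalClosure_minimal _ (iSup_le fun l => ?_)
      (Submodule.isClosed_topologicalClosure _)
    exact Submodule.topologicalClosure_mono
      (treeSpan_le E fun m hm _ => X_le_treeSpan E hm List.nil_prefix)

end TreeSpaces

end

end BRS

theorem mainTheorem8 (p : ℝ≥0∞) [Fact (1 ≤ p)] (hp : 1 < p) (hp' : p ≠ ∞)
    (E : BRS.IndepEmbeddings p) (α : Ordinal.{0}) (hα : α < ω₁) :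
    (∀ l : List BRS.Entry, BRS.InTree α l →
      (BRS.R0 E (BRS.base l + BRS.kappa l)).map (BRS.treeOp E l) = BRS.Y E α l) ∧
    BRS.IndepSpaces (fun l : BRS.Root α => BRS.Y E α l) ∧
    BRS.DistIso (BRS.R0 E α)
      (BRS.indepSum (fun _ : BRS.Root α => BRS.unitMeasure)
        (fun l : BRS.Root α => BRS.R0 E (BRS.base l + BRS.kappa l))) := by
  have ha : ∀ l : List BRS.Entry, BRS.InTree α l →
      (BRS.R0 E (BRS.base l + BRS.kappa l)).map (BRS.treeOp E l) = BRS.Y E α l := fun l hl => by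
    rw [BRS.base_add_kappa, BRS.map_treeOp_R0 E hα hl]
  have hb := BRS.indepSpaces_roots E hα
  refine ⟨ha, hb, ?_⟩
  have h1 : (fun l : BRS.Root α => BRS.Y E α l) = fun l : BRS.Root α =>
      (BRS.R0 E (BRS.base l + BRS.kappa l)).map (BRS.treeOp E l) :=
    funext fun l => (ha l l.2.1).symm
  have h2 := BRS.R0_eq_closure_roots E hα
  rw [h1] at hb
  rw [h1] at h2
  rw [h2]
  exact BRS.distIso_indepSum _ _ _ (fun l f => BRS.law_treeOp_root E hα l.2 f) hb
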